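/- Let $\phi=F_1\vee\dots\vee F_m$ be a DNF formula over $n$ Boolean variables ($m,n\ge1$) in which every cube $F_i$ is a consistent conjunction of $w$ literals on distinct variables, with the same width $w$ for all cubes. Let $0<\varepsilon<1$ and $0<\delta<1$, and put $$g(m,n,\varepsilon,\delta)=\frac{m\,n\,\log(1/\delta)}{\varepsilon^{2}},$$ which is the bound on the running time of the Karp–Luby–Madras Monte Carlo algorithm for DNF counting. The algorithm $\mathsf{SymbolicDNFApproxMC}(\phi,\varepsilon,\delta)$ is the following. Put $\mathsf{hiThresh}=2\bigl(1+9.84(1+\tfrac{\varepsilon}{1+\varepsilon})(1+\tfrac1\varepsilon)^2\bigr)$, $t=\lceil 17\log_2(3/\delta)\rceil$, $q=n-w+\lceil\log_2 m\rceil$ and $sI=\max(0,\,n-w-\lceil\log_2\lceil\mathsf{hiThresh}\rceil\rceil)$. The output is the median of $t$ independent estimates (found by merge sort), each of them computed as follows. * (SampleBase) Sample a $(q-1)\times(q-sI)$ bit matrix $\hat D$, whose first $sI$ rows are uniform and whose other rows form a random upper triangular matrix with diagonal entries $1$, and uniform vectors $\hat b,\hat y\in\{0,1\}^{q-1}$.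 * (BSAT) For $sI\le p\le q-1$, a cell count is obtained thus. Row-reduce the first $p$ rows of $(\hat D,\hat b,\hat y)$ to a Row-Echelon system $u\oplus Dv=b\oplus y$ with $u\in\{0,1\}^p$, $v\in\{0,1\}^{q-p}$, and enumerate its $2^{q-p}$ solutions $z=[u:v]$ in Gray code order. The last $\lceil\log_2m\rceil$ bits of $z$ are read as the index of a cube $F_i$, and its first $n-w$ bits as values of the variables not in $F_i$; this gives an assignment $x\models F_i$ (a $z$ whose index belongs to no cube is skipped). For each $x$, sample indices $j\in\{1,\dots,m\}$ uniformly until $x\models F_j$, and add (number of samples)$/m$ to the count; as soon as the count reaches $\mathsf{hiThresh}$, stop and return $\mathsf{hiThresh}$. * (LogSATSearch) By binary search over $p\in\{sI,\dots,q-1\}$, starting at $p=sI$, find a $p$ at which the cell count falls below $\mathsf{hiThresh}$; the level $sI-1$ counts as not below and the level $q-1$ as below. Call BSAT once more at this $p$; the estimate is $2^p$ times its result. Assume that the range of the binary search is not degenerate, that is, $q\ge2$. **Theorem.** $\mathsf{SymbolicDNFApproxMC}$ runs in time $\tilde O\bigl(mn\log(1/\delta)/\varepsilon^2\bigr)$ in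 the worst case over all its random choices. Precisely: there is $k\in\mathbb N$ such that for every $\delta_0\in(0,1)$ there is a constant $C>0$ such that for all $\phi,\varepsilon,\delta$ as above with $\delta\le\delta_0$ and for every outcome of the random choices, $\mathsf{SymbolicDNFApproxMC}(\phi,\varepsilon,\delta)$ halts after at most $$C\cdot g(m,n,\varepsilon,\delta)\cdot\log^{k}\bigl(2+g(m,n,\varepsilon,\delta)\bigr)$$ elementary steps. So its running time is within polylogarithmic factors of the Karp–Luby–Madras bound $g$. Elementary steps are those of a unit-cost random access machine (operations on counters, indices and the real parameters, and reads and writes of single array cells, cost one step; operations on vectors, matrices and numbers with many bits cost a step per entry or bit; a uniform draw from $\{1,\dots,k\}$ costs $1+\lceil\log_2k\rceil$ steps). -/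

import Mathlib

noncomputable section

namespace DNFCounting

/-! ### The machine model: a unit-cost random access machine with a clock

A program is a partial function of its random draws. It carries a clock that counts elementary
steps. Every elementary operation (arithmetic on counters, array indices and the real parameters,
a comparison, reading or writing one array cell, one loop test) takes one step; an operation on
vectors, matrices or numbers of many bits is charged one step per entry or bit. -/

/-- The outcomes of all random choices: `ω i k` is the outcome of the `i`-th draw if that draw is
from `{0, …, k - 1}` (a uniform and independent choice). -/
abbrev Draws : Type := ℕ → (k : ℕ) → 0 < k → Fin k

/-- Elementary steps made so far, and number of random draws made so far. -/
structure Status where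
  time : ℕ
  drawn : ℕ

/-- Programs with a result in `α`; `Part` accounts for programs that do not halt. -/
structure RAM (α : Type) where
  run : Draws → Status → Part (α × Status)

instance : Monad RAM where
  pure a := ⟨fun _ s => Part.some (a, s)⟩
  bind prog f := ⟨fun ω s => (prog.run ω s).bind fun r => (f r.1).run ω r.2⟩

/-- Spend `k` elementary steps. -/
def tick (k : ℕ) : RAM Unit := ⟨fun _ s => Part.some ((), { s with time := s.time + k })⟩

/-- Evaluate `a`, at the price of `k` elementary steps. -/
def op {α : Type} (k : ℕ) (a : α) : RAM α := do
  tick k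
  pure a

/-- A uniform draw from `{0, …, k - 1}`: one step, and one for each random bit needed. -/
def draw (k : ℕ) (hk : 0 < k) : RAM (Fin k) := do
  tick (Nat.clog 2 k + 1)
  ⟨fun ω s => Part.some (ω s.drawn k hk, { s with drawn := s.drawn + 1 })⟩

/-- A uniform random bit. -/
def coin : RAM Bool := do
  let c ← draw 2 Nat.two_pos
  pure (decide (c = 1))

/-- `k` rounds of a loop, with counter `a, a + 1, …`. Each round costs a step for control. -/
def forLoop {σ : Type} (body : ℕ → σ → RAM σ) : (k a : ℕ) → σ → RAM σ
  | 0, _, s => pure s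
  | k + 1, a, s => do
      tick 1
      let s ← body a s
      forLoop body k (a + 1) s

/-- `for (i = a; i < b; i++)`. -/
def forRange {σ : Type} (a b : ℕ) (s : σ) (body : ℕ → σ → RAM σ) : RAM σ :=
  forLoop body (b - a) a s

/-- One round of a loop, which ends with a result or with the next state. Each round costs a step
for control. -/
def loopRound {σ α : Type} (body : σ → RAM (α ⊕ σ)) (ω : Draws) :
    (σ × Status) →. ((α × Status) ⊕ (σ × Status)) := fun x =>
  ((do tick 1; body x.1 : RAM (α ⊕ σ)).run ω x.2).map fun y =>
    y.1.elim (fun r => Sum.inl (r, y.2)) fun s => Sum.inr (s, y.2)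

/-- Repeat `body` until it yields a result `inl r`; `inr s` goes on with the new state `s`. An
endless repetition has no value. -/
def loop {σ α : Type} (s : σ) (body : σ → RAM (α ⊕ σ)) : RAM α :=
  ⟨fun ω st => PFun.fix (loopRound body ω) (s, st)⟩

/-- Whatever the random choices are, the program halts, after at most `T` elementary steps. -/
def HaltsWithin {α : Type} (prog : RAM α) (T : ℝ) : Prop :=
  ∀ ω : Draws, ∃ r ∈ prog.run ω ⟨0, 0⟩, (r.2.time : ℝ) ≤ T

/-! ### Arrays of bits -/

/-- A bit array; only an initial segment is in use. -/
abbrev Vec : Type := ℕ → Bool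

/-- A two-dimensional bit array; only an initial rectangle is in use. -/
abbrev Mat : Type := ℕ → ℕ → Bool

/-- Write the cell `A[i,j]`. -/
def Mat.set (A : Mat) (i j : ℕ) (b : Bool) : Mat := Function.update A i (Function.update (A i) j b)

/-- The array `0`, of length `k`. -/
def zeroVector (k : ℕ) : RAM Vec :=
  op k fun _ => false

/-- A copy of `v[i:j]` (`j` excluded). -/
def subVector (v : Vec) (i j : ℕ) : RAM Vec :=
  forRange i j (fun _ => false : Vec) fun l u => op 1 (Function.update u (l - i) (v l))

/-- A copy of `A[r₁:r₂,c₁:c₂]` (`r₂` and `c₂` excluded). -/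
def subMatrix (A : Mat) (r₁ r₂ c₁ c₂ : ℕ) : RAM Mat :=
  forRange r₁ r₂ (fun _ _ => false : Mat) fun i B =>
    forRange c₁ c₂ B fun j B => op 1 (Mat.set B (i - r₁) (j - c₁) (A i j))

/-- `u ⊕ v`, for arrays of length `k`. -/
def xorVector (k : ℕ) (u v : Vec) : RAM Vec :=
  forRange 0 k (fun _ => false : Vec) fun l x => op 1 (Function.update x l (xor (u l) (v l)))

/-- The concatenation `[u : v]`, for `u` of length `k` and `v` of length `l`. -/
def concatVector (k l : ℕ) (u v : Vec) : RAM Vec :=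
  forRange 0 (k + l) (fun _ => false : Vec) fun i z =>
    op 1 (Function.update z i (if i < k then u i else v (i - k)))

/-- A uniformly random bit array of length `k`. -/
def sampleVector (k : ℕ) : RAM Vec :=
  forRange 0 k (fun _ => false : Vec) fun i v => do
    let c ← coin
    op 1 (Function.update v i c)

/-! ### DNF formulas -/

/-- A formula `F₀ ∨ ⋯ ∨ F_{m-1}` in disjunctive normal form over variables `x₀, …, x_{n-1}`. The cube
`F_i` is a consistent conjunction of literals: it contains the literal `x_v` if
`cube i v = some true`, the literal `¬ x_v` if `cube i v = some false`, and neither if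
`cube i v = none`. -/
structure DNF where
  n : ℕ
  m : ℕ
  n_pos : 0 < n
  m_pos : 0 < m
  cube : Fin m → Fin n → Option Bool

namespace DNF

variable (φ : DNF)

/-- The number of literals of the cube `F_i`. -/
def cubeWidth (i : Fin φ.m) : ℕ := (Finset.univ.filter fun v => (φ.cube i v).isSome).card

/-- All cubes have the same width. -/
def UniformWidth : Prop := ∀ i j, φ.cubeWidth i = φ.cubeWidth j

/-- The width of the (first) cube. -/
def width : ℕ := φ.cubeWidth ⟨0, φ.m_pos⟩

/-- The number of bits of a cube index: `log₂ m`, rounded up. -/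
def indexBits : ℕ := Nat.clog 2 φ.m

/-- The number `q = n - w + log m` of bits that encode a pair `(x, F_i)` with `x ⊨ F_i`. -/
def hashBits : ℕ := φ.n - φ.width + φ.indexBits

/-- The occurrence of the variable `v` in the cube `i` (a table lookup). -/
def lit (i v : ℕ) : Option Bool :=
  if h : i < φ.m ∧ v < φ.n then φ.cube ⟨i, h.1⟩ ⟨v, h.2⟩ else none

end DNF

/-! ### Sampling and extracting hash functions -/

/-- The base `(D̂, b̂, ŷ)` from which the hash functions and cells are extracted. -/
structure Base where
  D : Mat
  b : Vec
  y : Vec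

/-- `SampleBase(q, sI)`: `D̂` is the random `sI × (q - sI)` matrix `G` on top of the random upper
triangular `(q - sI - 1) × (q - sI)` matrix `E` with diagonal entries `1`. -/
def sampleBase (q sI : ℕ) : RAM Base := do
  let D ← forRange 0 sI (fun _ _ => false : Mat) fun i D =>
    forRange 0 (q - sI) D fun j D => do
      let c ← coin
      op 1 (Mat.set D i j c)
  let D ← forRange 0 (q - sI - 1) D fun i D =>
    forRange 0 (q - sI) D fun j D =>
      if j < i then op 1 (Mat.set D (sI + i) j false)
      else if j = i then op 1 (Mat.set D (sI + i) j true)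
      else do
        let c ← coin
        op 1 (Mat.set D (sI + i) j c)
  let b ← sampleVector (q - 1)
  let y ← sampleVector (q - 1)
  pure ⟨D, b, y⟩

/-- `Extract(D̂, b̂, ŷ, p, q, sI)`: a Row-Echelon hash function `(D, b)` with `p` constraints, and a
cell `y`. -/
def extract (B : Base) (p q sI : ℕ) : RAM (Mat × Vec × Vec) := do
  let D ← subMatrix B.D 0 p 0 (q - sI)
  let b ← subVector B.b 0 p
  let y ← subVector B.y 0 p
  let (D, b, y) ← forRange sI p (D, b, y) fun i s =>
    forRange 0 i s fun j (D, b, y) => do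
      let c ← op 1 (D j (i - sI))
      if c then do
        let D ← forRange 0 (q - sI) D fun l D => op 1 (Mat.set D j l (xor (D j l) (D i l)))
        let b ← op 1 (Function.update b j (xor (b j) (b i)))
        let y ← op 1 (Function.update y j (xor (y j) (y i)))
        pure (D, b, y)
      else pure (D, b, y)
  let D ← subMatrix D 0 p (p - sI) (q - sI)
  pure (D, b, y)

/-! ### Enumerating and counting a cell -/

/-- The position of the bit in which the `j`-th and the `(j + 1)`-st word of the binary reflected
Gray code differ, found by scanning the trailing zeros of `j + 1`. -/
def nextGrayBit (j : ℕ) : RAM ℕ :=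
  op (padicValNat 2 (j + 1) + 1) (padicValNat 2 (j + 1))

/-- `enumNextREX(D, u, v, k)`, where `u` has length `p` and `v` has length `f`. -/
def enumNextREX (p f : ℕ) (D : Mat) (u v : Vec) (k : ℕ) : RAM (Vec × Vec) := do
  let v' ← subVector v 0 f
  let v' ← op 1 (Function.update v' k (!v k))
  let u' ← xorVector p u fun i => D i k
  pure (u', v')

/-- `interpret(z)`: the last `log m` of the `q` bits of `z` are the index `i` of a cube, and the first
`n - w` bits assign the variables outside that cube. This gives the assignment `x` with `x ⊨ F_i`
that is returned. If `m` is not a power of two, an index that belongs to no cube can occur; then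
`z` encodes no pair and the result is `none`. -/
def interpret (φ : DNF) (z : Vec) : RAM (Option Vec) := do
  let i ← forRange (φ.n - φ.width) φ.hashBits 0 fun l i => op 2 (2 * i + (z l).toNat)
  tick 1
  if i < φ.m then do
    let (x, _) ← forRange 0 φ.n ((fun _ => false : Vec), 0) fun v (x, pos) =>
      match φ.lit i v with
      | some b => op 2 (Function.update x v b, pos)
      | none => op 3 (Function.update x v (z pos), pos + 1)
    pure (some x)
  else pure none

/-- The test `x ⊨ F_j`, literal by literal. -/
def satisfiesCube (φ : DNF) (x : Vec) (j : ℕ) : RAM Bool :=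
  forRange 0 φ.n true fun v ok =>
    match φ.lit j v with
    | some b => op 2 (ok && (x v == b))
    | none => op 1 ok

/-- `CheckSAT(x, F_i, count, hiThresh)`. -/
def checkSAT (φ : DNF) (x : Vec) (count hiThresh : ℝ) : RAM ℝ :=
  loop (0 : ℕ) fun c =>
    if count + (c : ℝ) / φ.m < hiThresh then do
      let j ← draw φ.m φ.m_pos
      let c ← op 1 (c + 1)
      let sat ← satisfiesCube φ x j
      if sat then op 1 (Sum.inl ((c : ℝ) / φ.m))
      else pure (Sum.inr c)
    else op 1 (Sum.inl ((c : ℝ) / φ.m))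

/-- `BSAT(φ, D̂, b̂, ŷ, hiThresh, p, q, sI)`. -/
def bsat (φ : DNF) (B : Base) (hiThresh : ℝ) (p q sI : ℕ) : RAM ℝ := do
  let (D, b, y) ← extract B p q sI
  let u ← xorVector p b y
  let v ← zeroVector (q - p)
  let cellSize ← op (q - p + 1) (2 ^ (q - p))
  loop ((0 : ℕ), (0 : ℝ), u, v) fun (j, count, u, v) =>
    if j < cellSize then do
      let z ← concatVector p (q - p) u v
      let ox ← interpret φ z
      let est ← match ox with
        | some x => checkSAT φ x count hiThresh
        | none => pure 0
      let count ← op 1 (count + est)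
      tick 1
      if hiThresh ≤ count then pure (Sum.inl hiThresh)
      else do
        let k ← nextGrayBit j
        let (u, v) ← enumNextREX p (q - p) D u v k
        let j ← op 1 (j + 1)
        pure (Sum.inr (j, count, u, v))
    else pure (Sum.inl count)

/-! ### The search for the number of constraints -/

/-- `LogSATSearch(φ, D̂, b̂, ŷ, hiThresh, low, hi)`, a binary search. The number `p` of constraints
corresponds to the index `i = p - low + 1` of `FailRecord`; `none` is `⊥`. -/
def logSATSearch (φ : DNF) (B : Base) (hiThresh : ℝ) (q low hi : ℕ) : RAM ℕ := do
  let top ← op 2 (hi - low + 1)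
  let fail : ℕ → Option Bool ← forRange 0 (top + 1) (fun _ => none) fun i fail =>
    op 1 (Function.update fail i
      (if i = 0 then some true else if i = top then some false else none))
  loop (0, top, low, fail) fun (lower, upper, p, fail) => do
    let i ← op 2 (p - low + 1)
    let count ← bsat φ B hiThresh p q low
    tick 2
    if hiThresh ≤ count then
      if fail (i + 1) = some false then op 1 (Sum.inl (p + 1))
      else do
        let fail ← forRange 1 (i + 1) fail fun l fail => op 1 (Function.update fail l (some true))
        let p' ← op 4 (low + (upper + i) / 2 - 1)
        pure (Sum.inr (i, upper, p', fail))
    else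
      if fail (i - 1) = some true then op 1 (Sum.inl p)
      else do
        let fail ← forRange i (top + 1) fail fun l fail => op 1 (Function.update fail l (some false))
        let p' ← op 4 (low + (i + lower) / 2 - 1)
        pure (Sum.inr (lower, i, p', fail))

/-! ### The median -/

/-- Merge two sorted lists of numbers of `bits` bits. -/
def mergeLists (bits : ℕ) : List ℝ → List ℝ → RAM (List ℝ)
  | [], ys => op 1 ys
  | xs, [] => op 1 xs
  | x :: xs, y :: ys => do
      tick (bits + 1)
      if x ≤ y then do
        let l ← mergeLists bits xs (y :: ys)
        op 1 (x :: l)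
      else do
        let l ← mergeLists bits (x :: xs) ys
        op 1 (y :: l)
  termination_by xs ys => xs.length + ys.length

/-- Merge sort. -/
def sortList (bits : ℕ) (l : List ℝ) : RAM (List ℝ) :=
  if h : l.length ≤ 1 then op 1 l
  else do
    tick (l.length + 1)
    let l₁ ← sortList bits (l.take (l.length / 2))
    let l₂ ← sortList bits (l.drop (l.length / 2))
    mergeLists bits l₁ l₂
  termination_by l.length
  decreasing_by
    · simp only [List.length_take]; omega
    · simp only [List.length_drop]; omega

/-- `FindMedian`, by sorting. -/
def findMedian (bits : ℕ) (l : List ℝ) : RAM ℝ := do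
  let s ← sortList bits l
  op (s.length + 1) (s.getD (s.length / 2) 0)

/-! ### The full algorithm -/

/-- `SymbolicDNFApproxMCCore(φ, hiThresh)`. The logarithms are rounded up, and `sI` is `0` when
`n - w - log hiThresh` is negative. -/
def symbolicDNFApproxMCCore (φ : DNF) (hiThresh : ℝ) : RAM (Option (ℕ × ℝ)) := do
  let w ← op (φ.n + 1) φ.width
  let q ← op (φ.indexBits + 3) (φ.n - w + φ.indexBits)
  let logThresh ← op (Nat.clog 2 ⌈hiThresh⌉₊ + 1) (Nat.clog 2 ⌈hiThresh⌉₊)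
  let sI ← op 2 (φ.n - w - logThresh)
  let B ← sampleBase q sI
  let p ← logSATSearch φ B hiThresh q sI (q - 1)
  let solCount ← bsat φ B hiThresh p q sI
  let cellCount ← op (p + 1) (2 ^ p)
  pure (some (cellCount, solCount))

/-- `SymbolicDNFApproxMC(φ, ε, δ)`. -/
def symbolicDNFApproxMC (φ : DNF) (ε δ : ℝ) : RAM ℝ := do
  let hiThresh ← op 12 (2 * (1 + 9.84 * (1 + ε / (1 + ε)) * (1 + 1 / ε) ^ 2))
  let t ← op (⌈17 * Real.logb 2 (3 / δ)⌉₊ + 1) ⌈17 * Real.logb 2 (3 / δ)⌉₊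
  let estimates ← forRange 0 t ([] : List ℝ) fun _ l => do
    let r ← symbolicDNFApproxMCCore φ hiThresh
    match r with
    | some (cellCount, solCount) => op (φ.hashBits + 1) (solCount * cellCount :: l)
    | none => pure l
  findMedian (φ.hashBits + 1) estimates

/-- The Karp–Luby–Madras Monte Carlo bound `m n log(1/δ) / ε²`. -/
def monteCarloBound (m n : ℕ) (ε δ : ℝ) : ℝ := m * n * Real.log (1 / δ) / ε ^ 2

end DNFCounting

end

/-! Write `q` for the number of hash bits, `H` for the ceiling of `hiThresh`, `T` for the number of
estimates, and `f = q - sI`. Since `sI` subtracts the rounded logarithm of `H` from `n - w`,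
truncated at zero, `f` is at most the sum of the rounded logarithms of `m` and `H`. Hence `2 ^ f ≤ 4
* m * H`: no cell examined has more than `O(m * H)` solutions, and Gray code order makes each of
them cost `O(n + log m)`.

The rejection sampling has no good bound for a single solution, so it is amortized over a whole cell
count. Every sample raises the count by `1 / m`, and sampling stops once the count reaches
`hiThresh`; thus one count uses at most `⌈m * hiThresh⌉` samples, each costing `O(n + log m)`,
whatever the draws are. This is `runs_checkSAT` and `runs_bsat`.

The search (`runs_logSATSearch`) ranges over only `f` levels, a logarithmic number, so it suffices
that each round shrinks the window by one; the halving is not needed. Extraction costs `O(q * f ^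
2)`, again linear in `n` up to logarithms. One estimate therefore costs `n * m * H` times powers of
logarithms, and the median adds only lower-order work.

Finally `H = O(1 / ε ^ 2)` and, for `δ ≤ δ₀`, `T = O(log (1 / δ))`. The bound `δ₀` is essential
here, because `log (1 / δ)` tends to zero as `δ` tends to `1` while `T` does not. All logarithms are
absorbed into `log (2 + g)`, since `m * H * T` is `O(2 + g)`. -/

namespace DNFCounting

/-! ### A program logic for worst-case running time -/

/-- Whatever the draws are, `prog` halts, and its result `a` and the number `t` of elementary steps
it makes satisfy `Q a t`. -/
def Runs {α : Type} (prog : RAM α) (Q : α → ℕ → Prop) : Prop :=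
  ∀ ω s, ∃ r ∈ prog.run ω s, ∃ t, r.2.time = s.time + t ∧ Q r.1 t

namespace Runs

variable {α β σ : Type}

protected theorem mono {prog : RAM α} {Q Q' : α → ℕ → Prop} (h : Runs prog Q)
    (hQ : ∀ a t, Q a t → Q' a t) : Runs prog Q' := fun ω s =>
  let ⟨r, hr, t, ht, hq⟩ := h ω s
  ⟨r, hr, t, ht, hQ _ _ hq⟩

protected theorem pure {a : α} {Q : α → ℕ → Prop} (h : Q a 0) : Runs (Pure.pure a) Q := fun _ s =>
  ⟨(a, s), Part.mem_some _, 0, rfl, h⟩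

protected theorem bind {prog : RAM α} {f : α → RAM β} {Q : α → ℕ → Prop} {R : β → ℕ → Prop}
    (h : Runs prog Q) (hf : ∀ a t, Q a t → Runs (f a) fun b t' => R b (t + t')) :
    Runs (prog >>= f) R := by
  intro ω s
  obtain ⟨r, hr, t, ht, hq⟩ := h ω s
  obtain ⟨r', hr', t', ht', hq'⟩ := hf _ _ hq ω r.2
  refine ⟨r', Part.mem_bind_iff.2 ⟨r, hr, hr'⟩, t + t', ?_, hq'⟩
  rw [ht', ht, add_assoc]

protected theorem tick {k : ℕ} {Q : Unit → ℕ → Prop} (h : Q () k) : Runs (tick k) Q := fun _ s =>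
  ⟨((), { s with time := s.time + k }), Part.mem_some _, k, rfl, h⟩

protected theorem op {k : ℕ} {a : α} {Q : α → ℕ → Prop} (h : Q a k) : Runs (op k a) Q :=
  Runs.bind (Q := fun _ t => t = k) (Runs.tick rfl) fun _ _ ht => Runs.pure (by simpa [ht] using h)

protected theorem draw {k : ℕ} {hk : 0 < k} {Q : Fin k → ℕ → Prop} (h : ∀ c, Q c (Nat.clog 2 k + 1)) :
    Runs (draw k hk) Q :=
  Runs.bind (Q := fun _ t => t = Nat.clog 2 k + 1) (Runs.tick rfl) fun _ t ht ω s =>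
    ⟨(ω s.drawn k hk, { s with drawn := s.drawn + 1 }), Part.mem_some _, 0, rfl, by
      simpa [ht] using h _⟩

protected theorem coin {Q : Bool → ℕ → Prop} (h : ∀ c, Q c 2) : Runs coin Q :=
  Runs.bind (Q := fun _ t => t = 2)
    (Runs.draw fun _ => congrArg (· + 1) (Nat.clog_pow 2 1 one_lt_two))
    fun _ _ ht => Runs.pure (by simpa [ht] using h _)

/-- `K` bounds every round uniformly; the extra step in `K + 1` pays for loop control. -/
protected theorem forLoop {body : ℕ → σ → RAM σ} {K : ℕ} (Inv : ℕ → σ → Prop) :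
    ∀ (k a : ℕ) (s : σ), Inv a s →
      (∀ i s, a ≤ i → i < a + k → Inv i s →
        Runs (body i s) fun s' t => t ≤ K ∧ Inv (i + 1) s') →
      Runs (forLoop body k a s) fun s' t => t ≤ k * (K + 1) ∧ Inv (a + k) s'
  | 0, a, s, h, _ => Runs.pure ⟨by simp, h⟩
  | k + 1, a, s, h, hb => by
      refine Runs.bind (Runs.tick (Q := fun _ t => t = 1) rfl) fun _ t ht => ?_
      refine Runs.bind (hb a s le_rfl (by omega) h) fun s' t' ⟨ht', h'⟩ => ?_
      refine Runs.mono (Runs.forLoop Inv k (a + 1) s' h' fun i s hi hi' => hb i s (by omega) (by omega))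
        fun s'' t'' ⟨ht'', h''⟩ => ⟨?_, ?_⟩
      · rw [add_mul]; omega
      · rwa [add_assoc, add_comm 1] at h''

protected theorem forRange {body : ℕ → σ → RAM σ} {a b K : ℕ} {s : σ} {Q : σ → ℕ → Prop}
    (Inv : ℕ → σ → Prop) (h : Inv a s)
    (hb : ∀ i s, a ≤ i → i < b → Inv i s → Runs (body i s) fun s' t => t ≤ K ∧ Inv (i + 1) s')
    (hQ : ∀ s' t, t ≤ (b - a) * (K + 1) → Inv (a + (b - a)) s' → Q s' t) :
    Runs (forRange a b s body) Q :=
  Runs.mono (Runs.forLoop Inv (b - a) a s h fun i s hi hi' => hb i s hi (by omega))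
    fun s' t ⟨ht, h'⟩ => hQ s' t ht h'

/-- A `for` loop of which only the running time matters. -/
theorem forRange_time {body : ℕ → σ → RAM σ} {a b K T : ℕ} {s : σ}
    (hb : ∀ i s, a ≤ i → i < b → Runs (body i s) fun _ t => t ≤ K)
    (hT : (b - a) * (K + 1) ≤ T) :
    Runs (forRange a b s body) fun _ t => t ≤ T :=
  Runs.forRange (fun _ _ => True) trivial
    (fun i s hi hi' _ => Runs.mono (hb i s hi hi') fun _ _ h => ⟨h, trivial⟩)
    fun _ _ h _ => h.trans hT

/-- The invariant `Inv` of a loop relates the state to the time that has elapsed. As each round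
takes time, the loop ends if the invariant bounds the elapsed time. -/
protected theorem loop {body : σ → RAM (α ⊕ σ)} {s : σ} {Q : α → ℕ → Prop} (Inv : σ → ℕ → Prop) (B : ℕ)
    (hB : ∀ s e, Inv s e → e ≤ B) (h : Inv s 0)
    (hb : ∀ s e, Inv s e → Runs (body s) fun r t =>
      r.elim (fun a => Q a (e + (t + 1))) fun s' => Inv s' (e + (t + 1))) :
    Runs (loop s body) Q := by
  intro ω st
  -- Induction on the remaining budget `B - e`, for an arbitrary state and clock.
  suffices H : ∀ d s e st, Inv s e → B - e = d → ∃ r ∈ PFun.fix (loopRound body ω) (s, st),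
      ∃ t, r.2.time = st.time + t ∧ Q r.1 (e + t) by
    have := H _ s 0 st h rfl
    simp only [zero_add] at this
    exact this
  intro d
  induction d using Nat.strong_induction_on with
  | _ d ih =>
  intro s e st hs hd
  -- The control tick gives `e < e + t`, so the budget strictly decreases whenever the loop goes on.
  have hrun := Runs.bind (Runs.tick (k := 1) (Q := fun _ t => t = 1) rfl) (f := fun _ => body s)
    (R := fun r t => r.elim (fun a => Q a (e + t)) fun s' => Inv s' (e + t) ∧ e < e + t)
    fun _ t ht => Runs.mono (hb s e hs) fun r t' hr => by
      cases r with
      | inl a => simpa [ht, add_comm 1] using hr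
      | inr s' => exact ⟨by simpa [ht, add_comm 1] using hr, by omega⟩
  obtain ⟨⟨r, st'⟩, hr, t, ht, hq⟩ := hrun ω st
  cases r with
  | inl a =>
    exact ⟨(a, st'), PFun.fix_stop ((Part.mem_map_iff _).2 ⟨_, hr, rfl⟩), t, ht, hq⟩
  | inr s' =>
    have hlt := hq.2
    have hle := hB _ _ hq.1
    obtain ⟨r, hr', t', ht', hq'⟩ := ih _ (by omega) s' (e + t) st' hq.1 rfl
    refine ⟨r, ?_, t + t', ?_, by rwa [← add_assoc]⟩
    · rwa [PFun.fix_fwd_eq (a' := (s', st')) ((Part.mem_map_iff _).2 ⟨_, hr, rfl⟩)]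
    · simp only at ht; rw [ht', ht, add_assoc]

/-- This and the next three rules keep exact costs, so that running through a program leaves only
linear arithmetic. -/
theorem op_bind {k : ℕ} {a : α} {f : α → RAM β} {R : β → ℕ → Prop}
    (h : Runs (f a) fun b t => R b (k + t)) : Runs (DNFCounting.op k a >>= f) R :=
  Runs.bind (Q := fun b t => b = a ∧ t = k) (Runs.op ⟨rfl, rfl⟩) fun _ _ ⟨ha, ht⟩ => ha ▸ ht ▸ h

theorem tick_bind {k : ℕ} {f : Unit → RAM β} {R : β → ℕ → Prop}
    (h : Runs (f ()) fun b t => R b (k + t)) : Runs (DNFCounting.tick k >>= f) R :=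
  Runs.bind (Q := fun _ t => t = k) (Runs.tick rfl) fun _ _ ht => ht ▸ h

theorem coin_bind {f : Bool → RAM β} {R : β → ℕ → Prop}
    (h : ∀ c, Runs (f c) fun b t => R b (2 + t)) : Runs (DNFCounting.coin >>= f) R :=
  Runs.bind (Q := fun _ t => t = 2) (Runs.coin fun _ => rfl) fun c _ ht => ht ▸ h c

theorem draw_bind {k : ℕ} {hk : 0 < k} {f : Fin k → RAM β} {R : β → ℕ → Prop}
    (h : ∀ c, Runs (f c) fun b t => R b (Nat.clog 2 k + 1 + t)) :
    Runs (DNFCounting.draw k hk >>= f) R :=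
  Runs.bind (Q := fun _ t => t = Nat.clog 2 k + 1) (Runs.draw fun _ => rfl) fun c _ ht => ht ▸ h c

end Runs

end DNFCounting

/-! ### Cost of array operations, hash extraction and membership tests -/

namespace DNFCounting

theorem runs_zeroVector (k : ℕ) : Runs (zeroVector k) fun _ t => t ≤ k := Runs.op le_rfl

theorem runs_subVector (v : Vec) (i j : ℕ) :
    Runs (subVector v i j) fun _ t => t ≤ 2 * (j - i) :=
  Runs.forRange_time (K := 1) (fun _ _ _ _ => Runs.op le_rfl) (by omega)

theorem runs_subMatrix (A : Mat) (r₁ r₂ c₁ c₂ : ℕ) :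
    Runs (subMatrix A r₁ r₂ c₁ c₂) fun _ t => t ≤ (r₂ - r₁) * (2 * (c₂ - c₁) + 1) :=
  Runs.forRange_time (fun _ _ _ _ =>
    Runs.forRange_time (K := 1) (fun _ _ _ _ => Runs.op le_rfl) (mul_comm _ _).le) le_rfl

theorem runs_xorVector (k : ℕ) (u v : Vec) : Runs (xorVector k u v) fun _ t => t ≤ 2 * k :=
  Runs.forRange_time (K := 1) (fun _ _ _ _ => Runs.op le_rfl) (by omega)

theorem runs_concatVector (k l : ℕ) (u v : Vec) :
    Runs (concatVector k l u v) fun _ t => t ≤ 2 * (k + l) :=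
  Runs.forRange_time (K := 1) (fun _ _ _ _ => Runs.op le_rfl) (by omega)

theorem runs_sampleVector (k : ℕ) : Runs (sampleVector k) fun _ t => t ≤ 4 * k :=
  Runs.forRange_time (K := 3) (fun _ _ _ _ => Runs.coin_bind fun _ => Runs.op le_rfl) (by omega)

theorem runs_sampleBase {q sI : ℕ} (h : sI ≤ q) :
    Runs (sampleBase q sI) fun _ t => t ≤ q * (4 * (q - sI) + 9) := by
  have hrow : ∀ {body : ℕ → Mat → RAM Mat} {D : Mat},
      (∀ j D, Runs (body j D) fun _ t => t ≤ 3) →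
      Runs (forRange 0 (q - sI) D body) fun _ t => t ≤ 4 * (q - sI) := fun h =>
    Runs.forRange_time (fun j D _ _ => h j D) (by omega)
  refine Runs.bind (Runs.forRange_time (T := sI * (4 * (q - sI) + 1))
    (fun i D _ _ => hrow fun j D => Runs.coin_bind fun _ => Runs.op le_rfl) le_rfl) fun D t₁ h₁ => ?_
  refine Runs.bind (Runs.forRange_time (T := (q - sI) * (4 * (q - sI) + 1))
    (fun i D _ _ => hrow fun j D => ?_) (Nat.mul_le_mul (by omega) le_rfl)) fun D t₂ h₂ => ?_
  · split_ifs
    · exact Runs.op (by norm_num)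
    · exact Runs.op (by norm_num)
    · exact Runs.coin_bind fun _ => Runs.op le_rfl
  refine Runs.bind (runs_sampleVector _) fun b t₃ h₃ => ?_
  refine Runs.bind (runs_sampleVector _) fun y t₄ h₄ => Runs.pure ?_
  have : sI * (4 * (q - sI) + 1) + (q - sI) * (4 * (q - sI) + 1) = q * (4 * (q - sI) + 1) := by
    rw [← add_mul]; congr 1; omega
  have : q * (4 * (q - sI) + 9) = q * (4 * (q - sI) + 1) + 8 * q := by ring
  omega

/-- At most `q - sI` pivot rows are eliminated, each from fewer than `q` rows that have only `q -
sI` columns. -/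
theorem runs_extract (B : Base) {p q sI : ℕ} (hp : p ≤ q) (hs : sI ≤ p) :
    Runs (extract B p q sI) fun _ t => t ≤ 10 * q * (q - sI + 1) ^ 2 := by
  refine Runs.bind (runs_subMatrix _ _ _ _ _) fun D t₁ h₁ => ?_
  refine Runs.bind (runs_subVector _ _ _) fun b t₂ h₂ => ?_
  refine Runs.bind (runs_subVector _ _ _) fun y t₃ h₃ => ?_
  refine Runs.bind (Runs.forRange_time (K := p * (2 * (q - sI) + 4))
    (T := (p - sI) * (p * (2 * (q - sI) + 4) + 1)) (fun i s _ hi => ?_) le_rfl) ?_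
  · refine Runs.forRange_time (K := 2 * (q - sI) + 3) ?_ (Nat.mul_le_mul (by omega) le_rfl)
    rintro j ⟨D, b, y⟩ _ _
    refine Runs.op_bind ?_
    split_ifs
    · refine Runs.bind (Runs.forRange_time (K := 1) (T := 2 * (q - sI))
        (fun _ _ _ _ => Runs.op le_rfl) (by omega)) fun _ t ht => ?_
      exact Runs.op_bind <| Runs.op_bind <| Runs.pure (by omega)
    · exact Runs.pure (by omega)
  · rintro ⟨D, b, y⟩ t₄ h₄
    refine Runs.bind (runs_subMatrix _ _ _ _ _) fun D t₅ h₅ => Runs.pure ?_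
    obtain ⟨f, hf⟩ : ∃ f, f = q - sI := ⟨_, rfl⟩
    rw [← hf] at h₁ h₄ h₅ ⊢
    simp only [Nat.sub_zero] at h₁ h₂ h₃ h₅
    have e₁ : p * (2 * f + 1) ≤ q * (2 * f + 1) := Nat.mul_le_mul hp le_rfl
    have e₄ : (p - sI) * (p * (2 * f + 4) + 1) ≤ f * (q * (2 * f + 4) + 1) :=
      Nat.mul_le_mul (by omega) (by gcongr)
    have e₅ : p * (2 * (f - (p - sI)) + 1) ≤ q * (2 * f + 1) := Nat.mul_le_mul hp (by omega)
    have : f ≤ q := by omega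
    -- The parenthesis is the slack; its truncated subtraction is genuine because `f ≤ q`.
    have e : 10 * q * (f + 1) ^ 2 = 2 * (q * (2 * f + 1)) + 4 * q + f * (q * (2 * f + 4) + 1) + f +
      (8 * (q * f ^ 2) + 12 * (q * f) + 4 * q - 2 * f) := by
      zify [show 2 * f ≤ 8 * (q * f ^ 2) + 12 * (q * f) + 4 * q by omega]; ring
    omega

theorem runs_nextGrayBit {j f : ℕ} (h : j < 2 ^ f) :
    Runs (nextGrayBit j) fun _ t => t ≤ f + 1 :=
  Runs.op <| Nat.succ_le_succ <| by
    have h₁ : 2 ^ padicValNat 2 (j + 1) ≤ j + 1 :=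
      Nat.le_of_dvd j.succ_pos pow_padicValNat_dvd
    exact (Nat.pow_le_pow_iff_right one_lt_two).1 (h₁.trans h)

theorem runs_enumNextREX (p f : ℕ) (D : Mat) (u v : Vec) (k : ℕ) :
    Runs (enumNextREX p f D u v k) fun _ t => t ≤ 2 * (p + f) + 1 := by
  refine Runs.bind (runs_subVector _ _ _) fun v' t₁ h₁ => Runs.op_bind ?_
  exact Runs.bind (runs_xorVector _ _ _) fun u' t₂ h₂ => Runs.pure (by omega)

theorem DNF.width_le (φ : DNF) : φ.width ≤ φ.n := by
  unfold DNF.width DNF.cubeWidth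
  exact (Finset.card_le_univ _).trans_eq (Fintype.card_fin φ.n)

theorem runs_interpret (φ : DNF) (z : Vec) :
    Runs (interpret φ z) fun _ t => t ≤ 3 * φ.indexBits + 4 * φ.n + 1 := by
  refine Runs.bind (Runs.forRange_time (K := 2) (T := 3 * φ.indexBits)
    (fun _ _ _ _ => Runs.op le_rfl) (by unfold DNF.hashBits; omega)) fun i t ht => ?_
  refine Runs.tick_bind ?_
  split_ifs
  · refine Runs.bind (Runs.forRange_time (K := 3) (T := 4 * φ.n) ?_ (by omega)) ?_
    · rintro v ⟨x, pos⟩ _ _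
      dsimp only
      split
      · exact Runs.op (by norm_num)
      · exact Runs.op (by norm_num)
    · rintro ⟨x, pos⟩ t' ht'
      exact Runs.pure (by omega)
  · exact Runs.pure (by omega)

theorem runs_satisfiesCube (φ : DNF) (x : Vec) (j : ℕ) :
    Runs (satisfiesCube φ x j) fun _ t => t ≤ 3 * φ.n := by
  refine Runs.forRange_time (K := 2) (fun v ok _ _ => ?_) (by omega)
  split
  · exact Runs.op (by norm_num)
  · exact Runs.op (by norm_num)

/-- The samples `c` that a call makes are charged to the count, which increases by `c / m`. -/
theorem runs_checkSAT (φ : DNF) (x : Vec) {a : ℕ} {hiThresh : ℝ} (ha : a ≤ ⌈φ.m * hiThresh⌉₊) :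
    Runs (checkSAT φ x (a / φ.m) hiThresh) fun est t => ∃ c : ℕ, est = c / φ.m ∧
      a + c ≤ ⌈φ.m * hiThresh⌉₊ ∧ t ≤ (φ.indexBits + 3 * φ.n + 4) * c + 2 := by
  have hm : (0 : ℝ) < φ.m := by exact_mod_cast φ.m_pos
  refine Runs.loop
    (fun c e => a + c ≤ ⌈φ.m * hiThresh⌉₊ ∧ e ≤ (φ.indexBits + 3 * φ.n + 4) * c)
    ((φ.indexBits + 3 * φ.n + 4) * ⌈φ.m * hiThresh⌉₊)
    (fun c e h => h.2.trans (Nat.mul_le_mul le_rfl (by omega))) ⟨ha, by simp⟩ ?_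
  rintro c e ⟨hc, he⟩
  split_ifs with hlt
  -- The loop test says `a + c < m * hiThresh`, so one more sample still stays within the ceiling.
  · have hc' : a + (c + 1) ≤ ⌈φ.m * hiThresh⌉₊ := by
      rw [← add_assoc, Nat.succ_le_iff, Nat.lt_ceil]
      rw [← add_div, div_lt_iff₀ hm, mul_comm] at hlt
      exact_mod_cast hlt
    refine Runs.draw_bind fun j => Runs.op_bind <| Runs.bind (runs_satisfiesCube φ x j) ?_
    intro sat t ht
    have hK : (φ.indexBits + 3 * φ.n + 4) * (c + 1) =
      (φ.indexBits + 3 * φ.n + 4) * c + (φ.indexBits + 3 * φ.n + 4) := by ring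
    have hM : Nat.clog 2 φ.m = φ.indexBits := rfl
    split_ifs
    · exact Runs.op ⟨c + 1, rfl, hc', by omega⟩
    · exact Runs.pure ⟨hc', by omega⟩
  · exact Runs.op ⟨c, rfl, hc, by omega⟩

end DNFCounting

/-! ### Cell counting, binary search and sorting -/

namespace DNFCounting

/-- Amortized analysis: time is charged partly to the solutions enumerated and partly to the samples
drawn, and both totals are bounded. -/
theorem runs_bsat (φ : DNF) (B : Base) (hiThresh : ℝ) {p sI : ℕ} (hp : p ≤ φ.hashBits)
    (hs : sI ≤ p) :
    Runs (bsat φ B hiThresh p φ.hashBits sI) fun _ t => t ≤ (φ.n + φ.indexBits + 1) *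
      (10 * (φ.hashBits - sI + 1) ^ 2 + 9 * 2 ^ (φ.hashBits - sI) +
        4 * ⌈φ.m * hiThresh⌉₊ + 6) := by
  have hm : (0 : ℝ) < φ.m := by exact_mod_cast φ.m_pos
  have hq : φ.hashBits ≤ φ.n + φ.indexBits := by unfold DNF.hashBits; omega
  obtain ⟨q, hq'⟩ : ∃ q, q = φ.hashBits := ⟨_, rfl⟩
  obtain ⟨A, hA⟩ : ∃ A, A = φ.n + φ.indexBits + 1 := ⟨_, rfl⟩
  obtain ⟨H, hH⟩ : ∃ H, H = ⌈φ.m * hiThresh⌉₊ := ⟨_, rfl⟩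
  rw [← hA, ← hH]
  rw [← hq'] at hp hq ⊢
  refine Runs.bind (runs_extract B hp hs) ?_
  rintro ⟨D, b, y⟩ t₁ h₁
  refine Runs.bind (runs_xorVector _ _ _) fun u t₂ h₂ => ?_
  refine Runs.bind (runs_zeroVector _) fun v t₃ h₃ => Runs.op_bind ?_
  have hN : 2 ^ (q - p) ≤ 2 ^ (q - sI) := Nat.pow_le_pow_right two_pos (by omega)
  refine Runs.mono (Q := fun _ t => t ≤ 9 * A * 2 ^ (q - p) + 4 * A * H + 1)
    -- Here `a` is the total number of samples so far, recovered from the count `a / m`. A solution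
    -- is charged `9 * A` and a sample `4 * A`.
    (Runs.loop (fun s e => ∃ a : ℕ, s.2.1 = a / φ.m ∧ a ≤ H ∧ s.1 ≤ 2 ^ (q - p) ∧
      e ≤ 9 * A * s.1 + 4 * A * a) (9 * A * 2 ^ (q - p) + 4 * A * H) ?_ ?_ ?_) ?_
  · rintro s e ⟨a, -, ha, hj, he⟩
    exact he.trans (by gcongr)
  · exact ⟨0, by simp, by simp, by simp, by simp⟩
  · rintro ⟨j, count, u, v⟩ e ⟨a, rfl, ha, hj, he⟩
    dsimp only at hj he ⊢
    split_ifs with hlt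
    · refine Runs.bind (runs_concatVector _ _ _ _) fun z t₄ h₄ => ?_
      refine Runs.bind (runs_interpret φ z) fun ox t₅ h₅ => ?_
      have hest : Runs (match ox with
          | some x => checkSAT φ x (a / φ.m) hiThresh
          | none => pure 0) fun est t => ∃ c : ℕ, est = c / φ.m ∧ a + c ≤ H ∧
            t ≤ 4 * A * c + 2 := by
        cases ox with
        -- An index that belongs to no cube draws no samples.
        | none => exact Runs.pure ⟨0, by simp, ha, by simp⟩
        | some x =>
          refine (runs_checkSAT φ x (hH ▸ ha)).mono ?_
          rintro est t ⟨c, hc, hac, ht⟩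
          exact ⟨c, hc, hH ▸ hac, ht.trans (by gcongr; omega)⟩
      cases ox
      all_goals
        refine Runs.bind hest ?_
        rintro est t₆ ⟨c, rfl, hc, h₆⟩
        have e₁ : 9 * A * (j + 1) = 9 * A * j + 9 * A := by ring
        have e₂ : 4 * A * (a + c) = 4 * A * a + 4 * A * c := by ring
        have e₃ : 9 * A * (j + 1) ≤ 9 * A * 2 ^ (q - p) := Nat.mul_le_mul le_rfl hlt
        have e₄ : 4 * A * (a + c) ≤ 4 * A * H := Nat.mul_le_mul le_rfl hc
        refine Runs.op_bind <| Runs.tick_bind ?_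
        split_ifs
        · exact Runs.pure (show _ ≤ _ by omega)
        · refine Runs.bind (runs_nextGrayBit hlt) fun k t₇ h₇ => ?_
          refine Runs.bind (runs_enumNextREX _ _ _ _ _ _) ?_
          rintro ⟨u, v⟩ t₈ h₈
          refine Runs.op_bind <| Runs.pure ⟨a + c, ?_, hc, hlt, ?_⟩
          · simp [add_div]
          · dsimp only
            omega
    · have e₁ : 9 * A * j ≤ 9 * A * 2 ^ (q - p) := Nat.mul_le_mul le_rfl hj
      have e₂ : 4 * A * a ≤ 4 * A * H := Nat.mul_le_mul le_rfl ha
      exact Runs.pure (show _ ≤ _ by omega)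
  · intro r t ht
    have e₁ : 10 * q * (q - sI + 1) ^ 2 ≤ 10 * A * (q - sI + 1) ^ 2 := by gcongr; omega
    have e₂ : 9 * A * 2 ^ (q - p) ≤ 9 * A * 2 ^ (q - sI) := by gcongr
    have e₃ : A * (10 * (q - sI + 1) ^ 2 + 9 * 2 ^ (q - sI) + 4 * H + 6) =
      10 * A * (q - sI + 1) ^ 2 + 9 * A * 2 ^ (q - sI) + 4 * A * H + 6 * A := by ring
    omega

/-- The window `lower < i < upper` of the binary search shrinks in each round. -/
theorem runs_logSATSearch (φ : DNF) (B : Base) (hiThresh : ℝ) {q low hi K : ℕ} (h : low < hi)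
    (hb : ∀ p, low ≤ p → p ≤ hi → Runs (bsat φ B hiThresh p q low) fun _ t => t ≤ K) :
    Runs (logSATSearch φ B hiThresh q low hi) fun p t => low ≤ p ∧ p ≤ hi ∧
      t ≤ (hi - low + 2) * (K + 2 * (hi - low) + 20) := by
  refine Runs.op_bind ?_
  obtain ⟨top, htop⟩ : ∃ top, top = hi - low + 1 := ⟨_, rfl⟩
  rw [← htop]
  refine Runs.bind (Q := fun fail t => t ≤ 2 * (top + 1) ∧ fail 0 = some true ∧
    fail top = some false ∧ ∀ l, 0 < l → l < top → fail l = none)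
    (Runs.forRange (K := 1) (fun k fail => ∀ l < k, fail l =
      if l = 0 then some true else if l = top then some false else none) (by simp) ?_ ?_) ?_
  · refine fun i fail _ _ ih => Runs.op ⟨le_rfl, fun l hl => ?_⟩
    rcases Nat.lt_succ_iff_lt_or_eq.1 hl with hl | rfl
    · rw [Function.update_of_ne hl.ne, ih l hl]
    · rw [Function.update_self]
  · intro fail t ht hf
    refine ⟨by omega, ?_, ?_, fun l h₀ h₁ => ?_⟩
    · rw [hf _ (by omega), if_pos rfl]
    · rw [hf _ (by omega), if_neg (by omega), if_pos rfl]
    · rw [hf _ (by omega), if_neg (by omega), if_neg (by omega)]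
  rintro fail t₀ ⟨ht₀, hf₀, hf₁, hf₂⟩
  obtain ⟨R, hR⟩ : ∃ R, R = K + 2 * top + 13 := ⟨_, rfl⟩
  refine Runs.mono (Q := fun p t => low ≤ p ∧ p ≤ hi ∧ t ≤ (top + 1) * R)
    -- The record is `true` at `lower`, `false` at `upper` and undetermined strictly between, where
    -- the index `p - low + 1` lies. Elapsed time is at most `R` per unit by which the window has
    -- shrunk.
    (Runs.loop (fun s e => low ≤ s.2.2.1 ∧ s.1 + low ≤ s.2.2.1 ∧ s.2.2.1 + 1 < low + s.2.1 ∧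
      s.2.1 ≤ top ∧ s.2.2.2 s.1 = some true ∧ s.2.2.2 s.2.1 = some false ∧
      (∀ l, s.1 < l → l < s.2.1 → s.2.2.2 l = none) ∧ e ≤ (top - (s.2.1 - s.1)) * R)
      ((top + 1) * R) ?_ ?_ ?_) ?_
  · rintro s e ⟨-, -, -, -, -, -, -, he⟩
    exact he.trans (Nat.mul_le_mul (by omega) le_rfl)
  · exact ⟨le_rfl, by simp, by dsimp only; omega, le_rfl, hf₀, hf₁, hf₂, by simp⟩
  · rintro ⟨lower, upper, p, fail⟩ e ⟨h₁, h₂, h₃, h₄, f₁, f₂, f₃, he⟩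
    dsimp only at h₁ h₂ h₃ h₄ f₁ f₂ f₃ he ⊢
    refine Runs.op_bind ?_
    obtain ⟨i, rfl⟩ : ∃ i, p = low + i := ⟨p - low, by omega⟩
    rw [Nat.add_sub_cancel_left]
    have hdone : (top - (upper - lower)) * R + R ≤ (top + 1) * R := by
      rw [← Nat.succ_mul]; exact Nat.mul_le_mul (by omega) le_rfl
    have hnext : ∀ d, d < upper - lower → (top - (upper - lower)) * R + R ≤ (top - d) * R := by
      intro d hd
      rw [← Nat.succ_mul]; exact Nat.mul_le_mul (by omega) le_rfl
    refine Runs.bind (hb _ h₁ (by omega)) fun count t₁ ht₁ => Runs.tick_bind ?_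
    split_ifs with hc hf hf
    · refine Runs.op ⟨by omega, by omega, by omega⟩
    -- Were the next index `upper`, its entry would be `false` and the search would have stopped; so
    -- the new window is nonempty. The other branch is symmetric.
    · have hlt : i + 1 + 1 < upper := by
        rcases (show i + 1 + 1 ≤ upper by omega).lt_or_eq with h | h
        · exact h
        · exact absurd (h ▸ f₂) hf
      refine Runs.bind (Q := fun fail' t => t ≤ 2 * (i + 1) ∧ ∀ l,
        fail' l = if 1 ≤ l ∧ l < i + 1 + 1 then some true else fail l)
        (Runs.forRange (K := 1) (fun k fail' => ∀ l, fail' l = if 1 ≤ l ∧ l < k then some true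
          else fail l) (fun l => (if_neg (by omega)).symm) ?_ ?_) ?_
      · refine fun k fail' hk _ ih => Runs.op ⟨le_rfl, fun l => ?_⟩
        rcases eq_or_ne l k with rfl | hl
        · rw [Function.update_self, if_pos (by omega)]
        · rw [Function.update_of_ne hl, ih l]
          exact if_congr (by omega) rfl rfl
      · intro fail' t ht hf
        refine ⟨by omega, fun l => ?_⟩
        rw [hf l]
        exact if_congr (by omega) rfl rfl
      rintro fail' t₂ ⟨ht₂, hf'⟩
      refine Runs.op_bind <| Runs.pure ?_
      have := hnext (upper - (i + 1)) (by omega)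
      refine ⟨by dsimp only; omega, by dsimp only; omega, by dsimp only; omega, h₄, ?_, ?_, ?_, ?_⟩
      · exact (hf' (i + 1)).trans (if_pos (by omega))
      · exact (hf' upper).trans ((if_neg (by omega)).trans f₂)
      · intro l hl hl'
        dsimp only at hl hl' ⊢
        exact (hf' _).trans ((if_neg (by omega)).trans (f₃ l (by omega) hl'))
      · dsimp only
        omega
    · exact Runs.op ⟨by omega, by omega, by omega⟩
    · have hlt : lower < i := by
        rcases (show lower ≤ i by omega).lt_or_eq with h | h
        · exact h
        · exact absurd (h ▸ f₁) hf
      refine Runs.bind (Q := fun fail' t => t ≤ 2 * (top + 1) ∧ ∀ l,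
        fail' l = if i + 1 ≤ l ∧ l < top + 1 then some false else fail l)
        (Runs.forRange (K := 1) (fun k fail' => ∀ l, fail' l = if i + 1 ≤ l ∧ l < k then some false
          else fail l) (fun l => (if_neg (by omega)).symm) ?_ ?_) ?_
      · refine fun k fail' hk _ ih => Runs.op ⟨le_rfl, fun l => ?_⟩
        rcases eq_or_ne l k with rfl | hl
        · rw [Function.update_self, if_pos (by omega)]
        · rw [Function.update_of_ne hl, ih l]
          exact if_congr (by omega) rfl rfl
      · intro fail' t ht hf
        refine ⟨by omega, fun l => ?_⟩
        rw [hf l]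
        exact if_congr (by omega) rfl rfl
      rintro fail' t₂ ⟨ht₂, hf'⟩
      refine Runs.op_bind <| Runs.pure ?_
      have := hnext (i + 1 - lower) (by omega)
      refine ⟨by dsimp only; omega, by dsimp only; omega, by dsimp only; omega,
        by dsimp only; omega, ?_, ?_, ?_, ?_⟩
      · exact (hf' lower).trans ((if_neg (by omega)).trans f₁)
      · exact (hf' (i + 1)).trans (if_pos (by omega))
      · intro l hl hl'
        dsimp only at hl hl' ⊢
        exact (hf' _).trans ((if_neg (by omega)).trans (f₃ l hl (by omega)))
      · dsimp only
        omega
  · rintro p t ⟨h₁, h₂, ht⟩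
    refine ⟨h₁, h₂, ?_⟩
    rw [hR] at ht
    have : (hi - low + 2) * (K + 2 * (hi - low) + 20) =
      (top + 1) * (K + 2 * top + 13) + 5 * (top + 1) := by
      rw [htop]; ring
    omega

theorem runs_mergeLists (bits : ℕ) (xs ys : List ℝ) :
    Runs (mergeLists bits xs ys) fun l t => l.length = xs.length + ys.length ∧
      t ≤ (bits + 2) * (xs.length + ys.length) + 1 := by
  fun_induction mergeLists bits xs ys with
  | case1 ys => exact Runs.op ⟨by simp, by simp⟩
  | case2 xs => exact Runs.op ⟨by simp, by simp⟩
  | case3 x xs y ys ih₁ ih₂ =>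
    refine Runs.tick_bind ?_
    split_ifs
    · refine Runs.bind ih₁ ?_
      rintro l t ⟨hl, ht⟩
      simp only [List.length_cons] at *
      exact Runs.op ⟨by simp; omega, by grind⟩
    · refine Runs.bind ih₂ ?_
      rintro l t ⟨hl, ht⟩
      simp only [List.length_cons] at *
      exact Runs.op ⟨by simp; omega, by grind⟩

/-- `c` bounds the depth of the recursion, and each level costs at most `(bits + 5) * l.length`. The
empty list is excluded because the bound would be zero while sorting it takes a step. -/
theorem runs_sortList (bits : ℕ) {c : ℕ} {l : List ℝ} (hl : l ≠ []) (hc : l.length ≤ 2 ^ c) :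
    Runs (sortList bits l) fun s t => s.length = l.length ∧
      t ≤ (bits + 5) * l.length * c + l.length := by
  induction c generalizing l with
  | zero =>
    rw [sortList, dif_pos (by simpa using hc)]
    exact Runs.op ⟨rfl, by have := List.length_pos_iff.2 hl; omega⟩
  | succ c ih =>
    have := List.length_pos_iff.2 hl
    rw [sortList]
    split_ifs with h
    · exact Runs.op ⟨rfl, by omega⟩
    have h₁ : (l.take (l.length / 2)).length = l.length / 2 := by simp; omega
    have h₂ : (l.drop (l.length / 2)).length = l.length - l.length / 2 := by simp
    rw [pow_succ] at hc
    refine Runs.tick_bind ?_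
    refine Runs.bind (ih (List.length_pos_iff.1 (by omega)) (by omega)) ?_
    rintro s₁ t₁ ⟨hs₁, ht₁⟩
    refine Runs.bind (ih (List.length_pos_iff.1 (by omega)) (by omega)) ?_
    rintro s₂ t₂ ⟨hs₂, ht₂⟩
    refine Runs.mono (runs_mergeLists bits s₁ s₂) ?_
    rintro s t ⟨hs, ht⟩
    rw [h₁] at hs₁ ht₁
    rw [h₂] at hs₂ ht₂
    rw [hs₁, hs₂] at hs ht
    have hsum : l.length / 2 + (l.length - l.length / 2) = l.length := by omega
    refine ⟨by omega, ?_⟩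
    rw [hsum] at ht
    have e : (bits + 5) * (l.length / 2) * c + (bits + 5) * (l.length - l.length / 2) * c =
        (bits + 5) * l.length * c := by rw [← add_mul, ← mul_add, hsum]
    have e₂ : (bits + 5) * l.length * (c + 1) =
      (bits + 5) * l.length * c + (bits + 2) * l.length + 3 * l.length := by ring
    omega

theorem runs_findMedian (bits : ℕ) {c T : ℕ} {l : List ℝ} (hT : l.length ≤ T) (hc : T ≤ 2 ^ c) :
    Runs (findMedian bits l) fun _ t => t ≤ (bits + 5) * T * c + 2 * T + 2 := by
  refine Runs.bind (Q := fun s t => s.length = l.length ∧ t ≤ (bits + 5) * T * c + T + 1) ?_ ?_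
  · rcases eq_or_ne l [] with rfl | hl
    · rw [sortList, dif_pos (by simp)]
      exact Runs.op ⟨rfl, by omega⟩
    · refine (runs_sortList bits hl (hT.trans hc)).mono ?_
      rintro s t ⟨hs, ht⟩
      refine ⟨hs, ht.trans ?_⟩
      have : (bits + 5) * l.length * c ≤ (bits + 5) * T * c := by gcongr
      omega
  · rintro s t ⟨hs, ht⟩
    exact Runs.op (by omega)

end DNFCounting

/-! ### Assembling the algorithm's integer cost bound -/

namespace DNFCounting

theorem two_pow_clog_le {x : ℕ} (hx : 0 < x) : 2 ^ Nat.clog 2 x ≤ 2 * x := by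
  rcases (show 1 ≤ x from hx).eq_or_lt with rfl | h
  · simp
  · have := Nat.pow_pred_clog_lt_self one_lt_two h
    have hpos := Nat.clog_pos one_lt_two h
    rw [← Nat.succ_pred_eq_of_pos hpos, pow_succ]
    omega

theorem clog_le_logb {x : ℕ} (hx : 0 < x) : (Nat.clog 2 x : ℝ) ≤ Real.logb 2 x + 1 := by
  have hx' : (0 : ℝ) < x := by exact_mod_cast hx
  have h : ((2 : ℝ)) ^ (Nat.clog 2 x : ℝ) ≤ 2 * x := by
    rw [Real.rpow_natCast]; exact_mod_cast two_pow_clog_le hx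
  have := (Real.le_logb_iff_rpow_le one_lt_two (by positivity)).2 h
  rwa [Real.logb_mul two_ne_zero hx'.ne', Real.logb_self_eq_one one_lt_two, add_comm] at this

/-- Of the four factors `l`, one bounds `n + log m` by a multiple of `n * l`, one counts search
rounds, and two cover the quadratic cost of extraction. -/
theorem runs_symbolicDNFApproxMCCore (φ : DNF) (hq : 2 ≤ φ.hashBits) {hiThresh : ℝ}
    (h : 2 < hiThresh) {l : ℕ} (hl : φ.indexBits + Nat.clog 2 ⌈hiThresh⌉₊ + 1 ≤ l) :
    Runs (symbolicDNFApproxMCCore φ hiThresh) fun _ t =>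
      t ≤ 800 * (φ.n * (φ.m * ⌈hiThresh⌉₊)) * l ^ 4 := by
  obtain ⟨H, hH⟩ : ∃ H, H = ⌈hiThresh⌉₊ := ⟨_, rfl⟩
  obtain ⟨ℓ, hℓ⟩ : ∃ ℓ, ℓ = Nat.clog 2 H := ⟨_, rfl⟩
  have hH2 : 2 < H := by rw [hH, Nat.lt_ceil]; exact_mod_cast h
  have hℓ2 : 2 ≤ ℓ := by
    rw [hℓ]; exact (Nat.lt_clog_iff_pow_lt one_lt_two).2 (by simpa using hH2)
  have hpow : 2 ^ ℓ ≤ 2 * H := hℓ ▸ two_pow_clog_le (by omega)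
  have hpow' : 2 ^ φ.indexBits ≤ 2 * φ.m := two_pow_clog_le φ.m_pos
  have hceil : ⌈φ.m * hiThresh⌉₊ ≤ φ.m * H := by
    rw [Nat.ceil_le, Nat.cast_mul, hH]
    exact mul_le_mul_of_nonneg_left (Nat.le_ceil _) (Nat.cast_nonneg _)
  have hw := φ.width_le
  have hn := φ.n_pos
  have hm := φ.m_pos
  unfold symbolicDNFApproxMCCore
  rw [← hH] at hl ⊢
  rw [← hℓ] at hl ⊢
  refine Runs.op_bind <| Runs.op_bind <| Runs.op_bind <| Runs.op_bind ?_
  have hq' : φ.n - φ.width + φ.indexBits = φ.hashBits := rfl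
  rw [hq']
  obtain ⟨sI, hsI⟩ : ∃ sI, sI = φ.n - φ.width - ℓ := ⟨_, rfl⟩
  obtain ⟨f, hf⟩ : ∃ f, f = φ.hashBits - sI := ⟨_, rfl⟩
  rw [← hsI]
  have hfl : f ≤ φ.indexBits + ℓ := by omega
  -- If the subtraction in `sI` is not truncated this follows from `2 ≤ ℓ`; otherwise `sI = 0` and
  -- `hq` applies.
  have hlow : sI < φ.hashBits - 1 := by omega
  refine Runs.bind (runs_sampleBase (by omega)) fun B t₁ h₁ => ?_
  refine Runs.bind (runs_logSATSearch φ B hiThresh hlow fun p hp hp' =>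
    runs_bsat φ B hiThresh (by omega) hp) ?_
  rintro p t₂ ⟨hp, hp', h₂⟩
  refine Runs.bind (runs_bsat φ B hiThresh (by omega) hp) fun c t₃ h₃ => ?_
  refine Runs.op_bind <| Runs.pure ?_
  obtain ⟨A, hA⟩ : ∃ A, A = φ.n + φ.indexBits + 1 := ⟨_, rfl⟩
  obtain ⟨X, hX⟩ : ∃ X, X = φ.m * H := ⟨_, rfl⟩
  rw [← hf] at h₁ h₂ h₃
  rw [show φ.hashBits - 1 - sI = f - 1 by omega] at h₂
  rw [← hA] at h₂ h₃
  rw [← hX] at hceil ⊢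
  have hf1 : f + 1 ≤ l := by omega
  have hX1 : 1 ≤ X := hX ▸ Nat.mul_pos hm (by omega)
  have hl1 : 1 ≤ l := by omega
  -- Each of the two rounded logarithms loses a factor of at most `2`.
  have hfX : 2 ^ f ≤ 4 * X := by
    calc 2 ^ f ≤ 2 ^ (φ.indexBits + ℓ) := Nat.pow_le_pow_right two_pos (by omega)
      _ = 2 ^ φ.indexBits * 2 ^ ℓ := pow_add _ _ _
      _ ≤ 2 * φ.m * (2 * H) := Nat.mul_le_mul hpow' hpow
      _ = 4 * X := by rw [hX]; ring
  have hAl : A ≤ 2 * (φ.n * l) := by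
    have : φ.n * 1 ≤ φ.n * l := Nat.mul_le_mul le_rfl hl1
    have : 1 * l ≤ φ.n * l := Nat.mul_le_mul hn le_rfl
    omega
  have hl2 : 1 ≤ l ^ 2 := Nat.one_le_pow _ _ hl1
  have hXl : X ≤ X * l ^ 2 := Nat.le_mul_of_pos_right _ hl2
  have hlX : l ^ 2 ≤ X * l ^ 2 := Nat.le_mul_of_pos_left _ hX1
  have hK : A * (10 * (f + 1) ^ 2 + 9 * 2 ^ f + 4 * ⌈φ.m * hiThresh⌉₊ + 6) ≤
      A * (56 * (X * l ^ 2)) := by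
    have : (f + 1) ^ 2 ≤ l ^ 2 := Nat.pow_le_pow_left hf1 2
    exact Nat.mul_le_mul le_rfl (by omega)
  obtain ⟨K, hK'⟩ : ∃ K, K = A * (10 * (f + 1) ^ 2 + 9 * 2 ^ f + 4 * ⌈φ.m * hiThresh⌉₊ + 6) :=
    ⟨_, rfl⟩
  rw [← hK'] at h₂ h₃ hK
  have hA1 : 1 ≤ A := by omega
  have hAl1 : 1 ≤ A * l := Nat.mul_pos hA1 hl1
  have b₁ : t₁ ≤ 9 * (A * l) :=
    h₁.trans ((Nat.mul_le_mul (show _ ≤ A by omega) (show _ ≤ 9 * l by omega)).trans_eq (by ring))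
  have b₂ : t₂ + t₃ ≤ 112 * (A * l * (X * l ^ 2)) + 20 * l ^ 2 := by
    calc t₂ + t₃ ≤ l * (K + 20 * l) + l * K := by
          refine add_le_add (h₂.trans (Nat.mul_le_mul (by omega) (by omega))) (h₃.trans ?_)
          exact Nat.le_mul_of_pos_left _ hl1
      _ = l * (2 * K) + 20 * l ^ 2 := by ring
      _ ≤ l * (2 * (A * (56 * (X * l ^ 2)))) + 20 * l ^ 2 := by gcongr
      _ = _ := by ring
  have b₃ : A ≤ A * l := Nat.le_mul_of_pos_right _ hl1
  have b₄ : l ≤ A * l := Nat.le_mul_of_pos_left _ hA1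
  have b₅ : A * l ≤ A * l * (X * l ^ 2) := Nat.le_mul_of_pos_right _ (by omega)
  have b₆ : X * l ^ 2 ≤ A * l * (X * l ^ 2) := Nat.le_mul_of_pos_left _ hAl1
  have b₇ : 400 * (A * l * (X * l ^ 2)) ≤ 800 * (φ.n * X) * l ^ 4 := by
    calc 400 * (A * l * (X * l ^ 2)) ≤ 400 * (2 * (φ.n * l) * l * (X * l ^ 2)) := by gcongr
      _ = _ := by ring
  omega

theorem runs_symbolicDNFApproxMC (φ : DNF) (hq : 2 ≤ φ.hashBits) {ε δ hiThresh : ℝ} {T l : ℕ}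
    (hh : hiThresh = 2 * (1 + 9.84 * (1 + ε / (1 + ε)) * (1 + 1 / ε) ^ 2)) (h : 2 < hiThresh)
    (hT : T = ⌈17 * Real.logb 2 (3 / δ)⌉₊) (hT0 : 0 < T)
    (hl : φ.indexBits + Nat.clog 2 ⌈hiThresh⌉₊ + Nat.clog 2 T + 1 ≤ l) :
    Runs (symbolicDNFApproxMC φ ε δ) fun _ t =>
      t ≤ 900 * (T * (φ.n * (φ.m * ⌈hiThresh⌉₊))) * l ^ 4 := by
  unfold symbolicDNFApproxMC
  rw [← hh, ← hT]
  refine Runs.op_bind <| Runs.op_bind ?_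
  obtain ⟨K, hK⟩ : ∃ K, K = 800 * (φ.n * (φ.m * ⌈hiThresh⌉₊)) * l ^ 4 := ⟨_, rfl⟩
  refine Runs.bind (Q := fun (s : List ℝ) t => t ≤ T * (K + φ.hashBits + 2) ∧ s.length ≤ T)
    (Runs.forRange (K := K + φ.hashBits + 1) (fun i s => s.length ≤ i) (by simp) ?_ ?_) ?_
  · intro i s _ _ hs
    refine Runs.bind (runs_symbolicDNFApproxMCCore φ hq h (l := l) (by omega)) fun r t ht => ?_
    rw [← hK] at ht
    cases r with
    | none => exact Runs.pure ⟨by omega, by omega⟩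
    | some r =>
      obtain ⟨c, s'⟩ := r
      exact Runs.op ⟨by omega, by simpa using hs⟩
  · intro s t ht hs
    exact ⟨by simpa using ht, by simpa using hs⟩
  · rintro s t ⟨ht, hs⟩
    refine (runs_findMedian _ hs (Nat.le_pow_clog one_lt_two T)).mono fun _ t' ht' => ?_
    have hn := φ.n_pos
    have hH : 0 < ⌈hiThresh⌉₊ := Nat.ceil_pos.2 (by linarith)
    have hX : 1 ≤ φ.m * ⌈hiThresh⌉₊ := Nat.mul_pos φ.m_pos hH
    have hl1 : 1 ≤ l := by omega
    have hqn : φ.hashBits + 1 ≤ φ.n + l := by unfold DNF.hashBits; omega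
    have hnl : φ.hashBits + 6 ≤ 7 * (φ.n * l) := by
      have : φ.n * 1 ≤ φ.n * l := Nat.mul_le_mul le_rfl hl1
      have : 1 * l ≤ φ.n * l := Nat.mul_le_mul hn le_rfl
      omega
    obtain ⟨W, hW⟩ : ∃ W, W = φ.n * (φ.m * ⌈hiThresh⌉₊) * l ^ 4 := ⟨_, rfl⟩
    have hW2 : φ.n * l * l ≤ W := by
      calc φ.n * l * l = φ.n * 1 * l ^ 2 := by ring
        _ ≤ φ.n * (φ.m * ⌈hiThresh⌉₊) * l ^ 4 := by gcongr; omega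
        _ = W := hW.symm
    have hW1 : φ.n * l ≤ φ.n * l * l := Nat.le_mul_of_pos_right _ hl1
    have hc : (φ.hashBits + 1 + 5) * Nat.clog 2 T ≤ 7 * W := by
      calc (φ.hashBits + 1 + 5) * Nat.clog 2 T ≤ 7 * (φ.n * l) * l :=
            Nat.mul_le_mul hnl (by omega)
        _ = 7 * (φ.n * l * l) := by ring
        _ ≤ 7 * W := by gcongr
    have hnl1 : 1 ≤ φ.n * l := Nat.mul_pos hn hl1
    calc _ ≤ 12 + (T + 1 + (T * (K + φ.hashBits + 2) +
          ((φ.hashBits + 1 + 5) * T * Nat.clog 2 T + 2 * T + 2))) := by gcongr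
      _ = T * (K + φ.hashBits + 5 + (φ.hashBits + 1 + 5) * Nat.clog 2 T) + 15 := by ring
      _ ≤ T * (K + φ.hashBits + 5 + (φ.hashBits + 1 + 5) * Nat.clog 2 T) + T * 15 := by omega
      _ = T * (K + φ.hashBits + 20 + (φ.hashBits + 1 + 5) * Nat.clog 2 T) := by ring
      _ ≤ T * (900 * W) := by
        refine Nat.mul_le_mul le_rfl ?_
        have : K = 800 * W := by rw [hK, hW]; ring
        omega
      _ = _ := by rw [hW]; ring

end DNFCounting

/-! ### Real estimates in terms of `ε` and `δ` -/

namespace DNFCounting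

theorem Runs.haltsWithin {α : Type} {prog : RAM α} {T : ℕ} {R : ℝ}
    (h : Runs prog fun _ t => t ≤ T) (hR : (T : ℝ) ≤ R) : HaltsWithin prog R := fun ω =>
  let ⟨r, hr, t, ht, hq⟩ := h ω ⟨0, 0⟩
  ⟨r, hr, by
    rw [ht]
    exact le_trans (by exact_mod_cast (zero_add t).trans_le hq) hR⟩

/-- `hiThresh` is `O(1/ε²)`. -/
theorem hiThresh_bounds {ε : ℝ} (h₀ : 0 < ε) (h₁ : ε < 1) :
    2 < 2 * (1 + 9.84 * (1 + ε / (1 + ε)) * (1 + 1 / ε) ^ 2) ∧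
      (⌈2 * (1 + 9.84 * (1 + ε / (1 + ε)) * (1 + 1 / ε) ^ 2)⌉₊ : ℝ) ≤ 161 / ε ^ 2 := by
  have hpos : 0 < 9.84 * (1 + ε / (1 + ε)) * (1 + 1 / ε) ^ 2 := by positivity
  refine ⟨by linarith, (Nat.ceil_lt_add_one (by linarith)).le.trans ?_⟩
  have e₁ : ε / (1 + ε) ≤ 1 := (div_le_one (by linarith)).2 (by linarith)
  have e₂ : (1 + 1 / ε) ^ 2 ≤ 4 / ε ^ 2 := by
    rw [show (1 + 1 / ε) = (ε + 1) / ε by field_simp, div_pow]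
    gcongr
    nlinarith
  -- This absorbs the additive constants: `2 * 9.84 * 2 * 4 + 3 = 160.44`, rounded up to `161`.
  have e₃ : 1 ≤ 1 / ε ^ 2 := by
    rw [le_div_iff₀ (by positivity)]; nlinarith
  have e₄ : 9.84 * (1 + ε / (1 + ε)) * (1 + 1 / ε) ^ 2 ≤ 9.84 * (1 + 1) * (4 / ε ^ 2) := by
    gcongr
  have e₅ : 4 / ε ^ 2 = 4 * (1 / ε ^ 2) := by ring
  have e₆ : 161 / ε ^ 2 = 161 * (1 / ε ^ 2) := by ring
  rw [e₅] at e₄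
  rw [e₆]
  linarith

/-- The number of estimates is `O(log(1/δ))`. -/
theorem exists_repetitions_le {δ₀ : ℝ} (h₀ : 0 < δ₀) (h₁ : δ₀ < 1) :
    ∃ c : ℝ, 1 ≤ c ∧ ∀ δ, 0 < δ → δ ≤ δ₀ → 0 < ⌈17 * Real.logb 2 (3 / δ)⌉₊ ∧
      (⌈17 * Real.logb 2 (3 / δ)⌉₊ : ℝ) ≤ c * Real.log (1 / δ) := by
  have hL₀ : 0 < Real.log (1 / δ₀) := Real.log_pos ((one_lt_div h₀).2 h₁)
  have h2 : 0 < Real.log 2 := Real.log_pos one_lt_two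
  have h3 : 0 < Real.log 3 := Real.log_pos (by norm_num)
  refine ⟨1 + (17 * (Real.log 3 / Real.log (1 / δ₀) + 1) / Real.log 2 + 1 / Real.log (1 / δ₀)),
    le_add_of_nonneg_right (by positivity), fun δ hδ hδ' => ?_⟩
  have hL : Real.log (1 / δ₀) ≤ Real.log (1 / δ) :=
    Real.log_le_log (by positivity) (one_div_le_one_div_of_le hδ hδ')
  have hlog : Real.logb 2 (3 / δ) = (Real.log 3 + Real.log (1 / δ)) / Real.log 2 := by
    rw [Real.logb, ← Real.log_mul (by norm_num) (by positivity), mul_one_div]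
  have hpos : 0 < Real.logb 2 (3 / δ) := by
    rw [hlog]; exact div_pos (by linarith) h2
  refine ⟨Nat.ceil_pos.2 (by linarith), (Nat.ceil_lt_add_one (by linarith)).le.trans ?_⟩
  -- Since `r ≥ 1`, multiplying the additive terms `log 3` and `1` by `r` makes them proportional to
  -- `log (1 / δ)`.
  obtain ⟨r, hr⟩ : ∃ r, r = Real.log (1 / δ) / Real.log (1 / δ₀) := ⟨_, rfl⟩
  have hr1 : 1 ≤ r := hr ▸ (one_le_div hL₀).2 hL
  calc 17 * Real.logb 2 (3 / δ) + 1
      = 17 * (Real.log 3 * 1 + Real.log (1 / δ)) / Real.log 2 + 1 := by rw [hlog]; ring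
    _ ≤ 17 * (Real.log 3 * r + Real.log (1 / δ)) / Real.log 2 + r := by gcongr
    _ = (17 * (Real.log 3 / Real.log (1 / δ₀) + 1) / Real.log 2 + 1 / Real.log (1 / δ₀)) *
        Real.log (1 / δ) := by rw [hr]; field_simp
    _ ≤ _ := by
      rw [one_add_mul]
      linarith

end DNFCounting

theorem mainTheorem2 :
    ∃ k : ℕ, ∀ δ₀ : ℝ, 0 < δ₀ → δ₀ < 1 → ∃ C : ℝ, 0 < C ∧
      ∀ (φ : DNFCounting.DNF) (ε δ : ℝ),
        φ.UniformWidth → 2 ≤ φ.hashBits → 0 < ε → ε < 1 → 0 < δ → δ ≤ δ₀ →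
          DNFCounting.HaltsWithin (DNFCounting.symbolicDNFApproxMC φ ε δ)
            (C * DNFCounting.monteCarloBound φ.m φ.n ε δ *
              Real.log (2 + DNFCounting.monteCarloBound φ.m φ.n ε δ) ^ k) := by
  refine ⟨4, fun δ₀ hδ₀ hδ₁ => ?_⟩
  obtain ⟨c, hc, hrep⟩ := DNFCounting.exists_repetitions_le hδ₀ hδ₁
  have h2 : 0 < Real.log 2 := Real.log_pos one_lt_two
  have hc0 : 0 < Real.log (161 * c) := Real.log_pos (by linarith)
  -- `b` is chosen so that the sum of all rounded logarithms is at most `b * log (2 + g)`, with some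
  -- slack.
  obtain ⟨b, hb⟩ : ∃ b, b = (Real.log (161 * c) / Real.log 2 + 1) / Real.log 2 + 5 / Real.log 2 :=
    ⟨_, rfl⟩
  have hb0 : 0 < b := by rw [hb]; positivity
  refine ⟨900 * (161 * c) * b ^ 4, by positivity, fun φ ε δ _ hq hε₀ hε₁ hδ hδ' => ?_⟩
  obtain ⟨hT₀, hT⟩ := hrep δ hδ hδ'
  obtain ⟨hh, hh'⟩ := DNFCounting.hiThresh_bounds hε₀ hε₁
  refine (DNFCounting.runs_symbolicDNFApproxMC φ hq rfl hh rfl hT₀ le_rfl).haltsWithin ?_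
  obtain ⟨T, hT'⟩ : ∃ T, T = ⌈17 * Real.logb 2 (3 / δ)⌉₊ := ⟨_, rfl⟩
  obtain ⟨H, hH⟩ : ∃ H, H = ⌈2 * (1 + 9.84 * (1 + ε / (1 + ε)) * (1 + 1 / ε) ^ 2)⌉₊ := ⟨_, rfl⟩
  have hH₀ : 0 < H := hH ▸ Nat.ceil_pos.2 (by linarith)
  rw [← hT'] at hT₀ hT ⊢
  rw [← hH] at hh' ⊢
  obtain ⟨g, hg⟩ : ∃ g, g = DNFCounting.monteCarloBound φ.m φ.n ε δ := ⟨_, rfl⟩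
  rw [← hg]
  have hδlt : δ < 1 := hδ'.trans_lt hδ₁
  have hL : 0 < Real.log (1 / δ) := Real.log_pos ((one_lt_div hδ).2 hδlt)
  have hm : (1 : ℝ) ≤ φ.m := by exact_mod_cast φ.m_pos
  have hn : (1 : ℝ) ≤ φ.n := by exact_mod_cast φ.n_pos
  have hprod : (T * (φ.n * (φ.m * H)) : ℝ) ≤ 161 * c * g := by
    calc (T * (φ.n * (φ.m * H)) : ℝ)
        ≤ c * Real.log (1 / δ) * (φ.n * (φ.m * (161 / ε ^ 2))) := by gcongr
      _ = 161 * c * g := by rw [hg, DNFCounting.monteCarloBound]; ring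
  have hg₀ : 0 < g := by rw [hg, DNFCounting.monteCarloBound]; positivity
  have hmHT : (φ.m * H * T : ℝ) ≤ 161 * c * (2 + g) := by
    calc (φ.m * H * T : ℝ) = T * (1 * (φ.m * H)) := by ring
      _ ≤ T * (φ.n * (φ.m * H)) := by gcongr
      _ ≤ 161 * c * g := hprod
      _ ≤ 161 * c * (2 + g) := by gcongr; linarith
  have hlog2 : Real.log 2 ≤ Real.log (2 + g) := Real.log_le_log two_pos (by linarith)
  have hl : ((φ.indexBits + Nat.clog 2 H + Nat.clog 2 T + 1 : ℕ) : ℝ) ≤ b * Real.log (2 + g) := by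
    have hT1 : (0 : ℝ) < T := by exact_mod_cast hT₀
    have hH1 : (0 : ℝ) < H := by exact_mod_cast hH₀
    have c₁ := DNFCounting.clog_le_logb φ.m_pos
    have c₂ := DNFCounting.clog_le_logb hH₀
    have c₃ := DNFCounting.clog_le_logb hT₀
    -- The three logarithms merge into that of `m * H * T`, bounded by `hmHT`. The remaining
    -- constants are then scaled by `log (2 + g) / log 2 ≥ 1`.
    have c₄ : Real.logb 2 φ.m + Real.logb 2 H + Real.logb 2 T ≤
        (Real.log (161 * c) + Real.log (2 + g)) / Real.log 2 := by
      rw [← Real.logb_mul (by positivity) (by positivity),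
        ← Real.logb_mul (by positivity) (by positivity), Real.logb,
        ← Real.log_mul (by positivity) (by positivity)]
      gcongr
    have c₅ : 1 ≤ Real.log (2 + g) / Real.log 2 := (one_le_div h2).2 hlog2
    push_cast
    rw [DNFCounting.DNF.indexBits]
    calc _ ≤ (Real.log (161 * c) + Real.log (2 + g)) / Real.log 2 + 4 := by linarith
      _ = Real.log (161 * c) / Real.log 2 * 1 + Real.log (2 + g) / Real.log 2 + 4 * 1 := by ring
      _ ≤ Real.log (161 * c) / Real.log 2 * (Real.log (2 + g) / Real.log 2) +
          Real.log (2 + g) / Real.log 2 + 4 * (Real.log (2 + g) / Real.log 2) := by gcongr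
      _ ≤ b * Real.log (2 + g) := by
        have : b * Real.log (2 + g) = Real.log (161 * c) / Real.log 2 *
          (Real.log (2 + g) / Real.log 2) + Real.log (2 + g) / Real.log 2 +
            5 * (Real.log (2 + g) / Real.log 2) := by rw [hb]; ring
        linarith
  calc _ = 900 * (T * (φ.n * (φ.m * H)) : ℝ) *
        ((φ.indexBits + Nat.clog 2 H + Nat.clog 2 T + 1 : ℕ) : ℝ) ^ 4 := by push_cast; ring
    _ ≤ 900 * (161 * c * g) * (b * Real.log (2 + g)) ^ 4 := by gcongr
    _ = _ := by ring
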